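/- Let $n,d\ge 0$ be integers, $T>0$, $\alpha>0$, let $f(x,m,v)\in\mathbb R$, $g(x,m,v)\in\mathbb R^n$, $\sigma(x)\in\mathbb R^{n\times n}$, $h(x,m)\in\mathbb R$ be functions of $x\in\mathbb R^n$, $m\in L^2(\mathbb R^n)$, $v\in\mathbb R^d$, and let $m_0\in L^2(\mathbb R^n)$ be a probability density. Put $a=\sigma\sigma^*$, $A\phi=-\frac12\sum_{i,j}a_{ij}\,\partial^2\phi/\partial x_i\partial x_j$, $$\tilde H(x,m,q,\rho)=\inf_{v}\{q\cdot g(x,m,v)+\rho f(x,m,v)\},$$ let $v^*(x,m,q,\rho)$ denote a minimizer, and put $\tilde F(x,m,q,\rho)=f(x,m,v^*(x,m,q,\rho))$, $\tilde G(x,m,q,\rho)=g(x,m,v^*(x,m,q,\rho))$. Write $\partial\Phi/\partial m(m)(\cdot)\in L^2(\mathbb R^n)$ for the Gateaux derivative of $\Phi:L^2(\mathbb R^n)\to\mathbb R$. Let $(u,\mu,m)$ solve the risk-sensitive adjoint system on $[0,T]$: $$u(x,z,T)=e^{\alpha[z+h(x,m(T))]}+\alpha\int e^{\alpha[\zeta+h(\xi,m(T))]}\,\frac{\partial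 h}{\partial m}(\xi,m(T))(x)\,\mu(d\xi,d\zeta,T),$$ $$-\frac{\partial u}{\partial t}+Au=\tilde H\Big(x,m,D_xu,\frac{\partial u}{\partial z}\Big)+\int\frac{\partial\tilde H}{\partial m}\Big(\xi,m,D_xu(\xi,\zeta,t),\frac{\partial u}{\partial z}(\xi,\zeta,t)\Big)(x)\,\mu(d\xi,d\zeta,t),\qquad 0<t<T,$$ $$\frac{\partial\mu}{\partial t}+A^*\mu+\mathrm{div}_x\Big(\tilde G\Big(x,m,D_xu,\frac{\partial u}{\partial z}\Big)\mu\Big)+\frac{\partial}{\partial z}\Big(\tilde F\Big(x,m,D_xu,\frac{\partial u}{\partial z}\Big)\mu\Big)=0,\qquad \mu(0)=m_0\otimes\delta_0,$$ where $\mu(t)$ is a probability measure on $\mathbb R^n\times\mathbb R$ whose marginal on $\mathbb R^n$ has the density $m(t)\in L^2(\mathbb R^n)$, the equation for $\mu$ holds in the weak sense (tested against $C_c^\infty(\mathbb R^n\times\mathbb R)$), all the integrals and Gateaux derivatives above exist, and at $q=D_xu$, $\rho=\partial u/\partial z$ the Hamiltonian $\tilde H(x,\cdot,q,\rho)$ is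 finite on $L^2(\mathbb R^n)$ and the infimum at $m(t)$ is attained at $v^*$. Assume that $u$ is of class $C^3$ on $\mathbb R^n\times\mathbb R\times(0,T)$ and that $u$ and $\chi:=\partial u/\partial z$ are continuous on $\mathbb R^n\times\mathbb R\times[0,T]$. Assume also that there are constants $K,C,c$ such that (i) $|\sigma_{ij}(x)|\le K$ for all $x,i,j$; (ii) $x\cdot\tilde G+\dfrac{z}{\sqrt{1+z^2}}\,\tilde F\le K(1+|x|^2+|z|)$ on $\mathbb R^n\times\mathbb R\times(0,T)$, with $\tilde F,\tilde G$ evaluated at $(x,m(t),D_xu(x,z,t),\frac{\partial u}{\partial z}(x,z,t))$; (iii) $\chi(x,z,t)\ge -C e^{c(|x|^2+|z|)}$ on $\mathbb R^n\times\mathbb R\times[0,T]$. Then $\chi$ solves $$\chi(x,z,T)=\alpha e^{\alpha[z+h(x,m(T))]},\qquad -\frac{\partial\chi}{\partial t}+A\chi=\frac{\partial\chi}{\partial z}\,\tilde F\Big(x,m,D_xu,\frac{\partial u}{\partial z}\Big)+D_x\chi\cdot\tilde G\Big(x,m,D_xu,\frac{\partial u}{\partial z}\Big)\quad(0<t<T),$$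 and $\chi(x,z,t)>0$ for all $(x,z,t)\in\mathbb R^n\times\mathbb R\times[0,T]$. -/

import Mathlib

open MeasureTheory Set
open scoped ContDiff

namespace RiskSensitive

/-- The state space `ℝⁿ` with its Euclidean norm. -/
abbrev E (n : ℕ) : Type := EuclideanSpace ℝ (Fin n)

/-- The space `L²(ℝⁿ)` in which the densities live. -/
abbrev L2 (n : ℕ) : Type := Lp ℝ 2 (volume : Measure (E n))

/-- The data of the control problem: running cost `f`, drift `g`, diffusion coefficient `σ`,
terminal cost `h`, risk-sensitivity index `α`, horizon `T`, initial density `m₀`. -/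
structure Model (n d : ℕ) where
  f : E n → L2 n → E d → ℝ
  g : E n → L2 n → E d → E n
  σ : E n → Matrix (Fin n) (Fin n) ℝ
  h : E n → L2 n → ℝ
  α : ℝ
  T : ℝ
  m₀ : L2 n

noncomputable section

/-- `m ∈ L²(ℝⁿ)` is a probability density. -/
def IsProbDensity {n : ℕ} (m : L2 n) : Prop :=
  (∀ᵐ x, 0 ≤ m x) ∧ ∫⁻ x, ENNReal.ofReal (m x) = 1

/-- The measure `m(x) dx`. -/
def densityMeasure {n : ℕ} (m : L2 n) : Measure (E n) :=
  volume.withDensity fun x => ENNReal.ofReal (m x)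

/-- `∂φ/∂xᵢ`. -/
def partialX {n : ℕ} (i : Fin n) (φ : E n → ℝ) (x : E n) : ℝ :=
  lineDeriv ℝ φ x (EuclideanSpace.single i 1)

/-- The Gateaux derivative of `Φ : L²(ℝⁿ) → ℝ` at `m` is represented by `k ∈ L²(ℝⁿ)`. -/
def HasGateauxGradient {n : ℕ} (Φ : L2 n → ℝ) (m : L2 n) (k : E n → ℝ) : Prop :=
  MemLp k 2 volume ∧
    ∀ w : L2 n, HasDerivAt (fun θ : ℝ => Φ (m + θ • w)) (∫ ξ, k ξ * w ξ) 0

namespace Model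

variable {n d : ℕ}

/-- `a = σ σ*`. -/
def a (P : Model n d) (x : E n) : Matrix (Fin n) (Fin n) ℝ :=
  P.σ x * (P.σ x).transpose

/-- `Aφ = -½ ∑ aᵢⱼ ∂²φ/∂xᵢ∂xⱼ`. -/
def A (P : Model n d) (φ : E n → ℝ) (x : E n) : ℝ :=
  -(1 / 2) * ∑ i, ∑ j, P.a x i j * partialX i (partialX j φ) x

/-- `q · g(x,m,v) + ρ f(x,m,v)`. -/
def preHam (P : Model n d) (x : E n) (m : L2 n) (q : E n) (ρ : ℝ) (v : E d) : ℝ :=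
  inner ℝ q (P.g x m v) + ρ * P.f x m v

/-- The Hamiltonian of the augmented state, `H̃(x,m,q,ρ) = inf_v { q · g + ρ f }`. -/
def Htilde (P : Model n d) (x : E n) (m : L2 n) (q : E n) (ρ : ℝ) : ℝ :=
  ⨅ v, P.preHam x m q ρ v

/-- `F̃(x,m,q,ρ) = f(x,m,v*(x,m,q,ρ))`. -/
def Ftilde (P : Model n d) (vstar : E n → L2 n → E n → ℝ → E d)
    (x : E n) (m : L2 n) (q : E n) (ρ : ℝ) : ℝ :=
  P.f x m (vstar x m q ρ)

/-- `G̃(x,m,q,ρ) = g(x,m,v*(x,m,q,ρ))`. -/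
def Gtilde (P : Model n d) (vstar : E n → L2 n → E n → ℝ → E d)
    (x : E n) (m : L2 n) (q : E n) (ρ : ℝ) : E n :=
  P.g x m (vstar x m q ρ)

end Model

/-- `D_x u(x,z,t)`. -/
def Dx {n : ℕ} (u : E n → ℝ → ℝ → ℝ) (x : E n) (z t : ℝ) : E n :=
  gradient (fun y => u y z t) x

/-- `∂u/∂z (x,z,t)`. -/
def Dz {n : ℕ} (u : E n → ℝ → ℝ → ℝ) (x : E n) (z t : ℝ) : ℝ :=
  deriv (fun ζ => u x ζ t) z

/-- `∂u/∂t (x,z,t)`. -/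
def Dt {n : ℕ} (u : E n → ℝ → ℝ → ℝ) (x : E n) (z t : ℝ) : ℝ :=
  deriv (fun s => u x z s) t

variable {n d : ℕ}

/-- `F̃(x, m(t), D_x u, ∂u/∂z)` at `(x,z,t)`. -/
def Model.loopF (P : Model n d) (vstar : E n → L2 n → E n → ℝ → E d)
    (u : E n → ℝ → ℝ → ℝ) (m : ℝ → L2 n) (x : E n) (z t : ℝ) : ℝ :=
  P.Ftilde vstar x (m t) (Dx u x z t) (Dz u x z t)

/-- `G̃(x, m(t), D_x u, ∂u/∂z)` at `(x,z,t)`. -/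
def Model.loopG (P : Model n d) (vstar : E n → L2 n → E n → ℝ → E d)
    (u : E n → ℝ → ℝ → ℝ) (m : ℝ → L2 n) (x : E n) (z t : ℝ) : E n :=
  P.Gtilde vstar x (m t) (Dx u x z t) (Dz u x z t)

/-- The generator of the state `(x,z)` under the optimal feedback, at time `t`, applied to a
test function `φ(x,z)`: `-Aφ + G̃ · D_xφ + F̃ ∂φ/∂z`. -/
def Model.generator (P : Model n d) (vstar : E n → L2 n → E n → ℝ → E d)
    (u : E n → ℝ → ℝ → ℝ) (m : ℝ → L2 n) (t : ℝ) (φ : E n × ℝ → ℝ) (p : E n × ℝ) : ℝ :=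
  -P.A (fun y => φ (y, p.2)) p.1
    + inner ℝ (gradient (fun y => φ (y, p.2)) p.1) (P.loopG vstar u m p.1 p.2 t)
    + deriv (fun ζ => φ (p.1, ζ)) p.2 * P.loopF vstar u m p.1 p.2 t

/-- `(u, μ, m)` is a solution of the risk-sensitive adjoint system: `u` is a classical solution
of the backward equation (of class `C³` inside the slab, with `u` and `∂u/∂z` continuous up to
the boundary `t = 0, T`), `μ` is a weak solution of the degenerate Fokker-Planck equation with
the optimal feedback, and `m(t)` is the density of the first marginal of `μ(t)`.
The functions `dh ξ m` and `dH ξ m q ρ` represent the Gateaux derivatives in `m` of `h(ξ, m)`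
and `H̃(ξ, m, q, ρ)`. -/
structure IsAdjointSolution (P : Model n d) (vstar : E n → L2 n → E n → ℝ → E d)
    (dh : E n → L2 n → E n → ℝ) (dH : E n → L2 n → E n → ℝ → E n → ℝ)
    (u : E n → ℝ → ℝ → ℝ) (μ : ℝ → Measure (E n × ℝ)) (m : ℝ → L2 n) : Prop where
  u_contDiffOn : ContDiffOn ℝ 3 (fun p : E n × ℝ × ℝ => u p.1 p.2.1 p.2.2)
    (univ ×ˢ univ ×ˢ Ioo 0 P.T)
  u_continuousOn : ContinuousOn (fun p : E n × ℝ × ℝ => u p.1 p.2.1 p.2.2)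
    (univ ×ˢ univ ×ˢ Icc 0 P.T)
  Dz_continuousOn : ContinuousOn (fun p : E n × ℝ × ℝ => Dz u p.1 p.2.1 p.2.2)
    (univ ×ˢ univ ×ˢ Icc 0 P.T)
  /-- Along the solution the infimum that defines `H̃` is finite, for every density argument. -/
  Htilde_finite : ∀ t ∈ Ioo 0 P.T, ∀ x z, ∀ m' : L2 n,
    BddBelow (range (P.preHam x m' (Dx u x z t) (Dz u x z t)))
  /-- Along the solution the infimum is attained at the feedback `v*`. -/
  vstar_optimal : ∀ t ∈ Ioo 0 P.T, ∀ x z,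
    IsMinOn (P.preHam x (m t) (Dx u x z t) (Dz u x z t)) univ
      (vstar x (m t) (Dx u x z t) (Dz u x z t))
  dh_gateaux : ∀ ξ, HasGateauxGradient (fun m' => P.h ξ m') (m P.T) (dh ξ (m P.T))
  dH_gateaux : ∀ t ∈ Ioo 0 P.T, ∀ ξ ζ,
    HasGateauxGradient (fun m' => P.Htilde ξ m' (Dx u ξ ζ t) (Dz u ξ ζ t)) (m t)
      (dH ξ (m t) (Dx u ξ ζ t) (Dz u ξ ζ t))
  terminal_integrable : ∀ x, Integrable
    (fun p : E n × ℝ => Real.exp (P.α * (p.2 + P.h p.1 (m P.T))) * dh p.1 (m P.T) x) (μ P.T)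
  terminal : ∀ x z, u x z P.T = Real.exp (P.α * (z + P.h x (m P.T)))
    + P.α * ∫ p : E n × ℝ, Real.exp (P.α * (p.2 + P.h p.1 (m P.T))) * dh p.1 (m P.T) x ∂μ P.T
  nonlocal_integrable : ∀ t ∈ Ioo 0 P.T, ∀ x, Integrable
    (fun p : E n × ℝ => dH p.1 (m t) (Dx u p.1 p.2 t) (Dz u p.1 p.2 t) x) (μ t)
  backward : ∀ t ∈ Ioo 0 P.T, ∀ x z,
    -Dt u x z t + P.A (fun y => u y z t) x = P.Htilde x (m t) (Dx u x z t) (Dz u x z t)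
      + ∫ p : E n × ℝ, dH p.1 (m t) (Dx u p.1 p.2 t) (Dz u p.1 p.2 t) x ∂μ t
  prob : ∀ t ∈ Icc 0 P.T, IsProbabilityMeasure (μ t)
  density : ∀ t ∈ Icc 0 P.T, IsProbDensity (m t) ∧
    (μ t).map Prod.fst = densityMeasure (m t)
  initial : μ 0 = (densityMeasure P.m₀).prod (Measure.dirac (0 : ℝ))
  fokkerPlanck : ∀ φ : E n × ℝ → ℝ, ContDiff ℝ ∞ φ → HasCompactSupport φ →
    (∀ᵐ s ∂(volume.restrict (Ioo 0 P.T)), Integrable (P.generator vstar u m s φ) (μ s)) ∧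
    IntervalIntegrable (fun s => ∫ p, P.generator vstar u m s φ p ∂μ s) volume 0 P.T ∧
    ∀ t ∈ Icc 0 P.T, ∫ p, φ p ∂μ t =
      ∫ p, φ p ∂μ 0 + ∫ s in (0 : ℝ)..t, ∫ p, P.generator vstar u m s φ p ∂μ s

end

end RiskSensitive

/-! The equation for `χ` is the envelope theorem without any differentiability of `H̃` or `v*`. Fix
`(x, t)` and freeze the control that is optimal at `z`. As `ζ` varies, its pre-Hamiltonian lies
above the Hamiltonian and touches it at `ζ = z`. By the backward equation the Hamiltonian equals
`-∂ₜu + Au` minus a nonlocal term that does not depend on `ζ`, so it is differentiable because `u`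
is `C³`. The derivative of the gap vanishes at its minimum, and symmetry of the derivatives of `u`
turns this into the equation for `χ` (`Dz_equation`).

Positivity is a maximum principle on an unbounded domain for a linear equation without zeroth-order
term. With `V = |x|²/2 + √(1+z²)`, add to `χ` the barrier `κ exp((c+1+Λ(t₂-t))V)`. It dominates the
allowed negative growth, so a value below the threshold would produce a minimum at a point. There
the first derivatives of `χ` are opposite to those of the barrier, whose gradient in `(x, z)` is a
nonnegative multiple of `(x, z/√(1+z²))`. Hence the one-sided drift bound is enough, and no
regularity of the drift is needed. A large `Λ` contradicts the equation (`not_min_of_barrier`).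

The required size of `Λ` depends on the exponent, which itself grows with `Λ` times the elapsed
time. The comparison is therefore made on steps of length `(c+1)/Λ`, on which the exponent stays
below `2(c+1)`, and is iterated backwards from `T`. Strictness survives each step because `κ` is
tuned to a local minimum of `χ` at the end of the step (`pos_of_pos_at_end`). -/

namespace RiskSensitive

/-! ### Directional derivatives: symmetry and the second-order term. -/

section LineDeriv

variable {X : Type*} [NormedAddCommGroup X] [NormedSpace ℝ X]

/-- Along a line, the derivative is the line derivative at the current point. -/
theorem deriv_along_line (φ : X → ℝ) (p v : X) (s : ℝ) :
    deriv (fun r : ℝ => φ (p + r • v)) s = lineDeriv ℝ φ (p + s • v) v := by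
  have h := deriv_comp_add_const (fun r : ℝ => φ (p + r • v)) s 0
  rw [zero_add] at h
  rw [← h, lineDeriv]
  congr 1
  funext r
  rw [add_smul, add_comm (r • v), add_assoc]

theorem lineDeriv_eqOn_fderiv {S : Set X} (hS : IsOpen S) {φ : X → ℝ} {k : WithTop ℕ∞}
    (hk : k ≠ 0) (hφ : ContDiffOn ℝ k φ S) (v : X) :
    EqOn (fun q => lineDeriv ℝ φ q v) (fun q => fderiv ℝ φ q v) S := fun _ hq =>
  ((hφ.differentiableOn hk).differentiableAt (hS.mem_nhds hq)).lineDeriv_eq_fderiv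

theorem contDiffOn_lineDeriv {S : Set X} (hS : IsOpen S) {φ : X → ℝ} {k l : WithTop ℕ∞}
    (hkl : k + 1 ≤ l) (hφ : ContDiffOn ℝ l φ S) (v : X) :
    ContDiffOn ℝ k (fun q => lineDeriv ℝ φ q v) S := by
  have hl : l ≠ 0 := by
    rintro rfl
    have : k + 1 = 0 := le_antisymm hkl zero_le
    simp at this
  exact ((hφ.fderiv_of_isOpen hS hkl).clm_apply contDiffOn_const).congr
    (lineDeriv_eqOn_fderiv hS hl hφ v)

theorem lineDeriv_congr_of_eqOn {S : Set X} (hS : IsOpen S) {φ ψ : X → ℝ} (h : EqOn φ ψ S)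
    {p : X} (hp : p ∈ S) (v : X) : lineDeriv ℝ φ p v = lineDeriv ℝ ψ p v :=
  (h.eventuallyEq_of_mem (hS.mem_nhds hp)).lineDeriv_eq

theorem lineDeriv_lineDeriv_eq_fderiv {S : Set X} (hS : IsOpen S) {φ : X → ℝ}
    (hφ : ContDiffOn ℝ 2 φ S) {p : X} (hp : p ∈ S) (v w : X) :
    lineDeriv ℝ (fun q => lineDeriv ℝ φ q v) p w = fderiv ℝ (fderiv ℝ φ) p w v := by
  rw [lineDeriv_congr_of_eqOn hS (lineDeriv_eqOn_fderiv hS two_ne_zero hφ v) hp]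
  have hd : DifferentiableAt ℝ (fderiv ℝ φ) p :=
    ((hφ.fderiv_of_isOpen hS (m := 1) (by norm_num [one_add_one_eq_two])).differentiableOn
      one_ne_zero).differentiableAt (hS.mem_nhds hp)
  have hd' := (hd.hasFDerivAt.clm_apply (hasFDerivAt_const v p))
  rw [hd'.differentiableAt.lineDeriv_eq_fderiv, hd'.fderiv]
  simp

theorem lineDeriv_comm {S : Set X} (hS : IsOpen S) {φ : X → ℝ}
    (hφ : ContDiffOn ℝ 2 φ S) {p : X} (hp : p ∈ S) (v w : X) :
    lineDeriv ℝ (fun q => lineDeriv ℝ φ q v) p w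
      = lineDeriv ℝ (fun q => lineDeriv ℝ φ q w) p v := by
  rw [lineDeriv_lineDeriv_eq_fderiv hS hφ hp, lineDeriv_lineDeriv_eq_fderiv hS hφ hp]
  exact (hφ.contDiffAt (hS.mem_nhds hp)).isSymmSndFDerivAt (by simp) w v

/-- Third line derivatives of a `C³` function can be reordered. -/
theorem lineDeriv_comm₃ {S : Set X} (hS : IsOpen S) {φ : X → ℝ}
    (hφ : ContDiffOn ℝ 3 φ S) {p : X} (hp : p ∈ S) (v w e : X) :
    lineDeriv ℝ (fun q => lineDeriv ℝ (fun r => lineDeriv ℝ φ r e) q v) p w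
      = lineDeriv ℝ (fun q => lineDeriv ℝ (fun r => lineDeriv ℝ φ r v) q w) p e := by
  have h2 : ContDiffOn ℝ 2 φ S := hφ.of_le (by norm_num)
  rw [lineDeriv_congr_of_eqOn hS (fun q hq => lineDeriv_comm hS h2 hq e v) hp]
  exact lineDeriv_comm hS (contDiffOn_lineDeriv hS (by norm_num) hφ v) hp e w

/-- A sum `∑ (σσᵀ)ᵢⱼ ∂ᵢ∂ⱼφ` is a sum of pure second derivatives along the columns of `σ`. -/
theorem sum_mul_transpose_lineDeriv {S : Set X} (hS : IsOpen S) {φ : X → ℝ}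
    (hφ : ContDiffOn ℝ 2 φ S) {p : X} (hp : p ∈ S) {ι : Type*} [Fintype ι]
    (σ : Matrix ι ι ℝ) (e : ι → X) :
    ∑ i, ∑ j, (σ * σ.transpose) i j
        * lineDeriv ℝ (fun q => lineDeriv ℝ φ q (e j)) p (e i)
      = ∑ k, lineDeriv ℝ (fun q => lineDeriv ℝ φ q (∑ i, σ i k • e i)) p (∑ i, σ i k • e i) := by
  simp only [lineDeriv_lineDeriv_eq_fderiv hS hφ hp, map_sum, map_smul,
    sum_apply, smul_apply, smul_eq_mul,
    Matrix.mul_apply, Matrix.transpose_apply, Finset.sum_mul, Finset.mul_sum]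
  rw [Finset.sum_congr rfl fun i _ => Finset.sum_comm, Finset.sum_comm]
  refine Finset.sum_congr rfl fun k _ => ?_
  rw [Finset.sum_comm]
  exact Finset.sum_congr rfl fun i _ => Finset.sum_congr rfl fun j _ => by ring

end LineDeriv

/-- Necessary second-order condition at a local minimum. -/
theorem deriv_deriv_nonneg_of_isLocalMin {f : ℝ → ℝ} {a : ℝ} (h : IsLocalMin f a)
    (hc : ContinuousAt f a) : 0 ≤ deriv (deriv f) a := by
  by_contra! hneg
  -- The second derivative test would make `a` a local maximum as well, so `f` would be locally
  -- constant and its second derivative zero.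
  have hmax := isLocalMax_of_deriv_deriv_neg hneg h.deriv_eq_zero hc
  have hev : f =ᶠ[nhds a] fun _ => f a := by
    filter_upwards [h, hmax] with x h1 h2 using le_antisymm h2 h1
  have : deriv (deriv f) a = 0 := by
    rw [hev.deriv.deriv_eq]; simp
  linarith

/-! ### Partial derivatives as directional derivatives on the product space. -/

section Slices

variable {n : ℕ}

/-- Both sides differentiate the same function of one variable up to a shift, so no smoothness is
needed and the identity can be reused with `Dz u` in place of `u`. -/
theorem Dz_eq_lineDeriv (u : E n → ℝ → ℝ → ℝ) (p : E n × ℝ × ℝ) :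
    Dz u p.1 p.2.1 p.2.2
      = lineDeriv ℝ (fun q : E n × ℝ × ℝ => u q.1 q.2.1 q.2.2) p (0, 1, 0) := by
  have h := deriv_comp_const_add (fun ζ => u p.1 ζ p.2.2) p.2.1 0
  rw [add_zero] at h
  rw [Dz, ← h, lineDeriv]
  simp

theorem Dt_eq_lineDeriv (u : E n → ℝ → ℝ → ℝ) (p : E n × ℝ × ℝ) :
    Dt u p.1 p.2.1 p.2.2
      = lineDeriv ℝ (fun q : E n × ℝ × ℝ => u q.1 q.2.1 q.2.2) p (0, 0, 1) := by
  have h := deriv_comp_const_add (fun s => u p.1 p.2.1 s) p.2.2 0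
  rw [add_zero] at h
  rw [Dt, ← h, lineDeriv]
  simp

theorem partialX_eq_lineDeriv (u : E n → ℝ → ℝ → ℝ) (i : Fin n) (p : E n × ℝ × ℝ) :
    partialX i (fun y => u y p.2.1 p.2.2) p.1
      = lineDeriv ℝ (fun q : E n × ℝ × ℝ => u q.1 q.2.1 q.2.2) p
          (EuclideanSpace.single i 1, 0, 0) := by
  simp [partialX, lineDeriv]

theorem partialX_partialX_eq_lineDeriv (u : E n → ℝ → ℝ → ℝ) (i j : Fin n) (p : E n × ℝ × ℝ) :
    partialX i (partialX j (fun y => u y p.2.1 p.2.2)) p.1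
      = lineDeriv ℝ (fun q => lineDeriv ℝ (fun q : E n × ℝ × ℝ => u q.1 q.2.1 q.2.2) q
          (EuclideanSpace.single j 1, 0, 0)) p (EuclideanSpace.single i 1, 0, 0) := by
  simp_rw [← partialX_eq_lineDeriv u j]
  exact partialX_eq_lineDeriv (fun y z t => partialX j (fun y => u y z t) y) i p

theorem inner_Dx_eq_lineDeriv {u : E n → ℝ → ℝ → ℝ} {p : E n × ℝ × ℝ}
    (hu : DifferentiableAt ℝ (fun q : E n × ℝ × ℝ => u q.1 q.2.1 q.2.2) p) (v : E n) :
    inner ℝ (Dx u p.1 p.2.1 p.2.2) v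
      = lineDeriv ℝ (fun q : E n × ℝ × ℝ => u q.1 q.2.1 q.2.2) p (v, 0, 0) := by
  have hd : DifferentiableAt ℝ (fun y => u y p.2.1 p.2.2) p.1 :=
    DifferentiableAt.comp (f := fun y : E n => (y, p.2.1, p.2.2))
      (g := fun q : E n × ℝ × ℝ => u q.1 q.2.1 q.2.2) p.1 hu (by fun_prop)
  rw [Dx, inner_gradient_left, ← hd.lineDeriv_eq_fderiv]
  simp [lineDeriv]

theorem A_eq_lineDeriv {d : ℕ} (P : Model n d) (u : E n → ℝ → ℝ → ℝ) (p : E n × ℝ × ℝ) :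
    P.A (fun y => u y p.2.1 p.2.2) p.1
      = -(1 / 2) * ∑ i, ∑ j, P.a p.1 i j * lineDeriv ℝ (fun q => lineDeriv ℝ
          (fun q : E n × ℝ × ℝ => u q.1 q.2.1 q.2.2) q
          (EuclideanSpace.single j 1, 0, 0)) p (EuclideanSpace.single i 1, 0, 0) := by
  simp_rw [Model.A, partialX_partialX_eq_lineDeriv]

end Slices

/-! ### The equation for `χ` by the envelope argument. -/

section BackwardEquation

variable {n d : ℕ}

theorem isOpen_slab (T : ℝ) : IsOpen (univ ×ˢ univ ×ˢ Ioo 0 T : Set (E n × ℝ × ℝ)) :=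
  isOpen_univ.prod (isOpen_univ.prod isOpen_Ioo)

theorem hasDerivAt_slice_z {ψ : E n × ℝ × ℝ → ℝ} {x : E n} {z t : ℝ}
    (h : DifferentiableAt ℝ ψ (x, z, t)) :
    HasDerivAt (fun ζ => ψ (x, ζ, t)) (lineDeriv ℝ ψ (x, z, t) (0, 1, 0)) z := by
  have hd : DifferentiableAt ℝ (fun ζ => ψ (x, ζ, t)) z :=
    DifferentiableAt.comp (f := fun ζ : ℝ => (x, ζ, t)) (g := ψ) z h (by fun_prop)
  have := Dz_eq_lineDeriv (fun x z t => ψ (x, z, t)) (x, z, t)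
  rw [← this]
  exact hd.hasDerivAt

variable {P : Model n d} {vstar : E n → L2 n → E n → ℝ → E d}
    {dh : E n → L2 n → E n → ℝ} {dH : E n → L2 n → E n → ℝ → E n → ℝ}
    {u : E n → ℝ → ℝ → ℝ} {μ : ℝ → Measure (E n × ℝ)} {m : ℝ → L2 n}

/-- The integral in the terminal condition does not depend on `z`, so only the exponential is
differentiated. -/
theorem Dz_terminal (hu : IsAdjointSolution P vstar dh dH u μ m) (x : E n) (z : ℝ) :
    Dz u x z P.T = P.α * Real.exp (P.α * (z + P.h x (m P.T))) := by
  simp only [Dz, hu.terminal]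
  have h : HasDerivAt (fun ζ : ℝ => P.α * (ζ + P.h x (m P.T))) (P.α * 1) z :=
    ((hasDerivAt_id z).add_const _).const_mul _
  rw [(h.exp.add_const _).deriv]
  ring

theorem uncurry_Dz (u : E n → ℝ → ℝ → ℝ) :
    (fun q : E n × ℝ × ℝ => Dz u q.1 q.2.1 q.2.2) = fun q =>
      lineDeriv ℝ (fun q : E n × ℝ × ℝ => u q.1 q.2.1 q.2.2) q (0, 1, 0) :=
  funext (Dz_eq_lineDeriv u)

theorem contDiffOn_Dz (hu : IsAdjointSolution P vstar dh dH u μ m) :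
    ContDiffOn ℝ 2 (fun q : E n × ℝ × ℝ => Dz u q.1 q.2.1 q.2.2)
      (univ ×ˢ univ ×ˢ Ioo 0 P.T) := by
  rw [uncurry_Dz]
  exact contDiffOn_lineDeriv (isOpen_slab _) (by norm_num) hu.u_contDiffOn _

/-- Differentiating the backward equation in `z`, by the envelope principle. -/
theorem Dz_equation (hu : IsAdjointSolution P vstar dh dH u μ m) {t : ℝ} (ht : t ∈ Ioo 0 P.T)
    (x : E n) (z : ℝ) :
    -Dt (Dz u) x z t + P.A (fun y => Dz u y z t) x
      = Dz (Dz u) x z t * P.loopF vstar u m x z t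
        + inner ℝ (Dx (Dz u) x z t) (P.loopG vstar u m x z t) := by
  set U : E n × ℝ × ℝ → ℝ := fun q => u q.1 q.2.1 q.2.2 with hU
  set S : Set (E n × ℝ × ℝ) := univ ×ˢ univ ×ˢ Ioo 0 P.T with hSdef
  have hS : IsOpen S := isOpen_slab _
  have hmem : ∀ ζ, (x, ζ, t) ∈ S := fun ζ => ⟨mem_univ _, mem_univ _, ht⟩
  have h3 : ContDiffOn ℝ 3 U S := hu.u_contDiffOn
  have h2 : ContDiffOn ℝ 2 U S := h3.of_le (by norm_num)
  have hdiff : ∀ {k : WithTop ℕ∞} {ψ : E n × ℝ × ℝ → ℝ}, k ≠ 0 → ContDiffOn ℝ k ψ S →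
      ∀ ζ, DifferentiableAt ℝ ψ (x, ζ, t) := fun hk hψ ζ =>
    (hψ.differentiableOn hk).differentiableAt (hS.mem_nhds (hmem ζ))
  have hC2 : ∀ v, ContDiffOn ℝ 2 (fun q => lineDeriv ℝ U q v) S := fun v =>
    contDiffOn_lineDeriv hS (by norm_num) h3 v
  have hC1 : ∀ v w, ContDiffOn ℝ 1
      (fun q => lineDeriv ℝ (fun r => lineDeriv ℝ U r v) q w) S := fun v w =>
    contDiffOn_lineDeriv hS (by norm_num) (hC2 v) w
  -- The control is frozen at its optimal value for `z`; it does not follow `ζ` below.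
  set v₀ := vstar x (m t) (Dx u x z t) (Dz u x z t) with hv₀
  set f₀ := P.f x (m t) v₀
  set g₀ := P.g x (m t) v₀
  -- The nonlocal term depends on `x` and `t` only, hence is a constant along the `z`-line.
  set c := ∫ p : E n × ℝ, dH p.1 (m t) (Dx u p.1 p.2 t) (Dz u p.1 p.2 t) x ∂μ t
  set e : Fin n → E n × ℝ × ℝ := fun i => (EuclideanSpace.single i 1, 0, 0) with he
  -- the Hamiltonian along the solution, read off from the backward equation
  set Φ : ℝ → ℝ := fun ζ => -lineDeriv ℝ U (x, ζ, t) (0, 0, 1)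
    + -(1 / 2) * ∑ i, ∑ j, P.a x i j
        * lineDeriv ℝ (fun q => lineDeriv ℝ U q (e j)) (x, ζ, t) (e i) - c with hΦdef
  have hΦ : ∀ ζ, Φ ζ = P.Htilde x (m t) (Dx u x ζ t) (Dz u x ζ t) := by
    intro ζ
    have hb := hu.backward t ht x ζ
    have h1 := Dt_eq_lineDeriv u (x, ζ, t)
    have h2 := A_eq_lineDeriv P u (x, ζ, t)
    simp only at h1 h2
    rw [h1, h2] at hb
    simp only [hΦdef]
    linarith
  set Ψ : ℝ → ℝ := fun ζ => lineDeriv ℝ U (x, ζ, t) (g₀, 0, 0)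
    + lineDeriv ℝ U (x, ζ, t) (0, 1, 0) * f₀ with hΨdef
  have hΨ : ∀ ζ, Ψ ζ = P.preHam x (m t) (Dx u x ζ t) (Dz u x ζ t) v₀ := by
    intro ζ
    have h1 := inner_Dx_eq_lineDeriv (u := u) (p := (x, ζ, t)) (hdiff two_ne_zero h2 ζ) g₀
    have h2 := Dz_eq_lineDeriv u (x, ζ, t)
    simp only at h1 h2
    rw [Model.preHam, h1, h2]
  have hle : ∀ ζ, Φ ζ ≤ Ψ ζ := fun ζ => by
    rw [hΦ, hΨ]
    exact ciInf_le (hu.Htilde_finite t ht x ζ (m t)) v₀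
  have heq : Φ z = Ψ z := by
    refine le_antisymm (hle z) ?_
    rw [hΦ, hΨ]
    exact le_ciInf fun v => hu.vstar_optimal t ht x z (mem_univ v)
  have hmin : IsLocalMin (fun ζ => Ψ ζ - Φ ζ) z := by
    refine Filter.Eventually.of_forall fun ζ => ?_
    have := hle ζ
    simp only [heq, sub_self]
    linarith
  -- Differentiability of the Hamiltonian in `ζ` comes from its expression through `u`; this is
  -- where third derivatives of `u` enter.
  have dΦ : HasDerivAt Φ (-lineDeriv ℝ (fun q => lineDeriv ℝ U q (0, 0, 1)) (x, z, t) (0, 1, 0)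
      + -(1 / 2) * ∑ i, ∑ j, P.a x i j * lineDeriv ℝ
        (fun q => lineDeriv ℝ (fun r => lineDeriv ℝ U r (e j)) q (e i)) (x, z, t) (0, 1, 0)) z := by
    refine (HasDerivAt.add (hasDerivAt_slice_z (hdiff two_ne_zero (hC2 _) z)).neg
      (HasDerivAt.const_mul _ (HasDerivAt.fun_sum fun i _ => HasDerivAt.fun_sum fun j _ =>
        HasDerivAt.const_mul _ (hasDerivAt_slice_z (hdiff one_ne_zero (hC1 (e j) (e i)) z))))
      ).sub_const c
  have dΨ : HasDerivAt Ψ (lineDeriv ℝ (fun q => lineDeriv ℝ U q (g₀, 0, 0)) (x, z, t) (0, 1, 0)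
      + lineDeriv ℝ (fun q => lineDeriv ℝ U q (0, 1, 0)) (x, z, t) (0, 1, 0) * f₀) z :=
    (hasDerivAt_slice_z (hdiff two_ne_zero (hC2 _) z)).add
      ((hasDerivAt_slice_z (hdiff two_ne_zero (hC2 _) z)).mul_const f₀)
  have hzero := hmin.hasDerivAt_eq_zero (dΨ.sub dΦ)
  have e1 := Dt_eq_lineDeriv (Dz u) (x, z, t)
  have e2 := Dz_eq_lineDeriv (Dz u) (x, z, t)
  have e3 := A_eq_lineDeriv P (Dz u) (x, z, t)
  have e4 := inner_Dx_eq_lineDeriv (u := Dz u) (p := (x, z, t))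
    (hdiff two_ne_zero (contDiffOn_Dz hu) z) g₀
  simp only [uncurry_Dz] at e1 e2 e3 e4
  -- By definition `f₀` and `g₀` are the closed-loop `F̃` and `G̃` at `(x, z, t)`.
  change -_ + _ = _ * f₀ + inner ℝ _ g₀
  rw [e1, e2, e3, e4, lineDeriv_comm hS h2 (hmem z) (0, 1, 0) (0, 0, 1),
    lineDeriv_comm hS h2 (hmem z) (0, 1, 0) (g₀, 0, 0)]
  have e5 : ∑ i, ∑ j, P.a x i j * lineDeriv ℝ (fun q => lineDeriv ℝ
        (fun r => lineDeriv ℝ U r (0, 1, 0)) q (e j)) (x, z, t) (e i)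
      = ∑ i, ∑ j, P.a x i j * lineDeriv ℝ (fun q => lineDeriv ℝ
        (fun r => lineDeriv ℝ U r (e j)) q (e i)) (x, z, t) (0, 1, 0) :=
    Finset.sum_congr rfl fun i _ => Finset.sum_congr rfl fun j _ =>
      congrArg (P.a x i j * ·) (lineDeriv_comm₃ hS h3 (hmem z) (e j) (e i) (0, 1, 0))
  rw [e5]
  linarith

end BackwardEquation

/-! ### Maximum principle with an exponential barrier. -/

section MaximumPrinciple

variable {n : ℕ}

/-- The Lyapunov function `|x|²/2 + √(1+z²)`. -/
noncomputable def lyapunov (x : E n) (z : ℝ) : ℝ := ‖x‖ ^ 2 / 2 + √(1 + z ^ 2)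

theorem continuous_lyapunov : Continuous fun p : E n × ℝ × ℝ => lyapunov p.1 p.2.1 := by
  unfold lyapunov
  fun_prop

theorem abs_le_sqrt_one_add_sq (z : ℝ) : |z| ≤ √(1 + z ^ 2) :=
  Real.abs_le_sqrt (by linarith)

theorem one_le_lyapunov (x : E n) (z : ℝ) : 1 ≤ lyapunov x z := by
  have : 1 ≤ √(1 + z ^ 2) := Real.one_le_sqrt.2 (by nlinarith)
  unfold lyapunov
  nlinarith [sq_nonneg ‖x‖]

theorem sq_norm_le_lyapunov (x : E n) (z : ℝ) : ‖x‖ ^ 2 ≤ 2 * lyapunov x z := by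
  have := Real.sqrt_nonneg (1 + z ^ 2)
  unfold lyapunov
  linarith

theorem abs_le_lyapunov (x : E n) (z : ℝ) : |z| ≤ lyapunov x z := by
  have := abs_le_sqrt_one_add_sq z
  unfold lyapunov
  nlinarith [sq_nonneg ‖x‖]

theorem sq_norm_add_abs_le_lyapunov (x : E n) (z : ℝ) :
    ‖x‖ ^ 2 + |z| ≤ 2 * lyapunov x z := by
  have := abs_le_sqrt_one_add_sq z
  have := abs_nonneg z
  unfold lyapunov
  linarith

/-- Coercivity of the Lyapunov function makes minima exist despite the unbounded domain; the case `s
= t` serves for a single time slice. -/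
theorem isCompact_lyapunov_le (R s t : ℝ) :
    IsCompact {p : E n × ℝ × ℝ | lyapunov p.1 p.2.1 ≤ R ∧ p.2.2 ∈ Icc s t} := by
  have hK : IsCompact (Metric.closedBall (0 : E n) (2 * R + 1) ×ˢ Icc (-R) R ×ˢ Icc s t) :=
    (isCompact_closedBall _ _).prod (isCompact_Icc.prod isCompact_Icc)
  refine hK.of_isClosed_subset ?_ ?_
  · have h1 : IsClosed {p : E n × ℝ × ℝ | lyapunov p.1 p.2.1 ≤ R} :=
      isClosed_le continuous_lyapunov continuous_const
    have h2 : IsClosed {p : E n × ℝ × ℝ | p.2.2 ∈ Icc s t} :=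
      isClosed_Icc.preimage (continuous_snd.comp continuous_snd)
    exact h1.inter h2
  · rintro ⟨x, z, r⟩ ⟨h, hr⟩
    simp only at h hr
    refine ⟨?_, abs_le.1 ((abs_le_lyapunov x z).trans h), hr⟩
    have := sq_norm_le_lyapunov x z
    simp only [Metric.mem_closedBall, dist_zero_right]
    nlinarith [sq_nonneg (‖x‖ - 1)]

/-- A classical solution of the linear backward equation
`-∂ₜχ - ½ tr(σσ* D²χ) = F ∂_zχ + G · D_xχ`. The second-order term is written with the second
derivatives along the columns of `σ`. -/
structure IsLinearSolution (σ : E n → Matrix (Fin n) (Fin n) ℝ) (F : E n → ℝ → ℝ → ℝ)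
    (G : E n → ℝ → ℝ → E n) (T : ℝ) (χ : E n × ℝ × ℝ → ℝ) : Prop where
  contDiffOn : ContDiffOn ℝ 2 χ (univ ×ˢ univ ×ˢ Ioo 0 T)
  continuousOn : ContinuousOn χ (univ ×ˢ univ ×ˢ Icc 0 T)
  equation : ∀ t ∈ Ioo 0 T, ∀ x z,
    -lineDeriv ℝ χ (x, z, t) (0, 0, 1) + -(1 / 2) * ∑ k, lineDeriv ℝ
        (fun q => lineDeriv ℝ χ q (WithLp.toLp 2 ((σ x).col k), 0, 0)) (x, z, t)
          (WithLp.toLp 2 ((σ x).col k), 0, 0)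
      = lineDeriv ℝ χ (x, z, t) (0, 1, 0) * F x z t + lineDeriv ℝ χ (x, z, t) (G x z t, 0, 0)

theorem norm_sq_toLp_col_le {σ : Matrix (Fin n) (Fin n) ℝ} {K : ℝ} (hσ : ∀ i j, |σ i j| ≤ K)
    (k : Fin n) : ‖(WithLp.toLp 2 (σ.col k) : E n)‖ ^ 2 ≤ n * K ^ 2 := by
  rw [EuclideanSpace.norm_sq_eq]
  calc ∑ i, ‖(WithLp.toLp 2 (σ.col k) : E n) i‖ ^ 2 ≤ ∑ _i : Fin n, K ^ 2 := by
        refine Finset.sum_le_sum fun i _ => ?_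
        exact pow_le_pow_left₀ (norm_nonneg _) (hσ i k) 2
    _ = n * K ^ 2 := by simp

/-- The derivative at the left end of an interval on which the left end is the minimum. -/
theorem nonneg_deriv_of_forall_le {f : ℝ → ℝ} {f' t t₂ : ℝ} (htt : t < t₂)
    (hf : HasDerivAt f f' t) (hmin : ∀ r ∈ Icc t t₂, f t ≤ f r) : 0 ≤ f' := by
  have hs := (hasDerivWithinAt_iff_tendsto_slope' (s := Ioi t) (by simp)).1
    hf.hasDerivWithinAt
  refine ge_of_tendsto hs ?_
  filter_upwards [Ioo_mem_nhdsGT htt] with r hr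
  rw [slope_def_field]
  exact div_nonneg (sub_nonneg.2 (hmin r (Ioo_subset_Icc_self hr))) (sub_nonneg.2 hr.1.le)

variable {σ : E n → Matrix (Fin n) (Fin n) ℝ} {F : E n → ℝ → ℝ → ℝ}
  {G : E n → ℝ → ℝ → E n} {T : ℝ} {χ : E n × ℝ × ℝ → ℝ}

/-- First derivative in time at a minimum of `χ` plus the barrier. -/
theorem time_derivative_at_min {x : E n} {z t t₂ l₀ Λ κ : ℝ} (htt : t < t₂)
    (hd : DifferentiableAt ℝ χ (x, z, t))
    (hmin : ∀ r ∈ Icc t t₂,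
      χ (x, z, t) + κ * Real.exp ((l₀ + Λ * (t₂ - t)) * lyapunov x z)
        ≤ χ (x, z, r) + κ * Real.exp ((l₀ + Λ * (t₂ - r)) * lyapunov x z)) :
    κ * Real.exp ((l₀ + Λ * (t₂ - t)) * lyapunov x z) * (Λ * lyapunov x z)
      ≤ lineDeriv ℝ χ (x, z, t) (0, 0, 1) := by
  have h1 : HasDerivAt (fun r => χ (x, z, r)) (lineDeriv ℝ χ (x, z, t) (0, 0, 1)) t := by
    have hd' : DifferentiableAt ℝ (fun r => χ (x, z, r)) t :=
      DifferentiableAt.comp (f := fun r : ℝ => (x, z, r)) (g := χ) t hd (by fun_prop)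
    rw [← Dt_eq_lineDeriv (fun x z t => χ (x, z, t)) (x, z, t)]
    exact hd'.hasDerivAt
  have h2 : HasDerivAt (fun r : ℝ => (l₀ + Λ * (t₂ - r)) * lyapunov x z)
      (Λ * (-1) * lyapunov x z) t :=
    ((((hasDerivAt_id t).const_sub t₂).const_mul Λ).const_add l₀).mul_const _
  -- Only later times are compared, since the minimum may sit at the initial time of the interval;
  -- an inequality is all this gives.
  have := nonneg_deriv_of_forall_le htt (h1.add (h2.exp.const_mul κ)) hmin
  linarith

/-- First derivative in `z` at a minimum of `χ` plus the barrier. -/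
theorem z_derivative_at_min {x : E n} {z t l κ : ℝ}
    (hd : DifferentiableAt ℝ χ (x, z, t))
    (hmin : ∀ ζ, χ (x, z, t) + κ * Real.exp (l * lyapunov x z)
        ≤ χ (x, ζ, t) + κ * Real.exp (l * lyapunov x ζ)) :
    lineDeriv ℝ χ (x, z, t) (0, 1, 0)
      = -(κ * Real.exp (l * lyapunov x z) * (l * (z / √(1 + z ^ 2)))) := by
  have h2 : HasDerivAt (fun ζ : ℝ => l * lyapunov x ζ) (l * (z / √(1 + z ^ 2))) z := by
    have h : HasDerivAt (fun ζ : ℝ => 1 + ζ ^ 2) (2 * z) z := by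
      simpa using (hasDerivAt_pow 2 z).const_add 1
    have h' := ((h.sqrt (by positivity)).const_add (‖x‖ ^ 2 / 2)).const_mul l
    rw [mul_div_mul_left _ _ two_ne_zero] at h'
    exact h'
  have hloc : IsLocalMin (fun ζ => χ (x, ζ, t) + κ * Real.exp (l * lyapunov x ζ)) z :=
    Filter.Eventually.of_forall hmin
  have := hloc.hasDerivAt_eq_zero ((hasDerivAt_slice_z hd).add (h2.exp.const_mul κ))
  linarith

/-- Along a line in `x` the Lyapunov function is a quadratic polynomial in the parameter. -/
theorem hasDerivAt_lyapunov_line (x v : E n) (z s : ℝ) :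
    HasDerivAt (fun r : ℝ => lyapunov (x + r • v) z) (inner ℝ x v + s * ‖v‖ ^ 2) s := by
  have heq : (fun r : ℝ => lyapunov (x + r • v) z)
      = fun r : ℝ => (‖x‖ ^ 2 / 2 + √(1 + z ^ 2)) + (r * inner ℝ x v + r ^ 2 * (‖v‖ ^ 2 / 2)) := by
    funext r
    rw [lyapunov, norm_add_sq_real, inner_smul_right, norm_smul, mul_pow, Real.norm_eq_abs, sq_abs]
    ring
  rw [heq]
  have h := (((hasDerivAt_id s).mul_const (inner ℝ x v)).add
    ((hasDerivAt_pow 2 s).mul_const (‖v‖ ^ 2 / 2))).const_add (‖x‖ ^ 2 / 2 + √(1 + z ^ 2))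
  refine h.congr_deriv ?_
  push_cast
  ring

/-- First and second derivatives in `x` at a minimum of `χ` plus the barrier. -/
theorem x_derivatives_at_min {S : Set (E n × ℝ × ℝ)} (hS : IsOpen S)
    (hχ : ContDiffOn ℝ 2 χ S) {x : E n} {z t l κ : ℝ} (hp : (x, z, t) ∈ S)
    (hmin : ∀ y, χ (x, z, t) + κ * Real.exp (l * lyapunov x z)
        ≤ χ (y, z, t) + κ * Real.exp (l * lyapunov y z)) (v : E n) :
    lineDeriv ℝ χ (x, z, t) (v, 0, 0)
        = -(κ * Real.exp (l * lyapunov x z) * (l * inner ℝ x v)) ∧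
      -(κ * Real.exp (l * lyapunov x z) * (l * ‖v‖ ^ 2 + l ^ 2 * inner ℝ x v ^ 2))
        ≤ lineDeriv ℝ (fun q => lineDeriv ℝ χ q (v, 0, 0)) (x, z, t) (v, 0, 0) := by
  set p : E n × ℝ × ℝ := (x, z, t)
  set V : E n × ℝ × ℝ := (v, 0, 0)
  set b : ℝ → ℝ := fun s => κ * Real.exp (l * lyapunov (x + s • v) z)
  set f : ℝ → ℝ := fun s => χ (p + s • V) + b s with hf
  have hb : ∀ s, HasDerivAt b (κ * (Real.exp (l * lyapunov (x + s • v) z)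
      * (l * (inner ℝ x v + s * ‖v‖ ^ 2)))) s := fun s =>
    (((hasDerivAt_lyapunov_line x v z s).const_mul l).exp).const_mul κ
  have hline : ∀ s : ℝ, p + s • V = (x + s • v, z, t) := fun s => by simp [p, V]
  have hloc : IsLocalMin f 0 := by
    refine Filter.Eventually.of_forall fun s => ?_
    simp only [hf, hline, b, zero_smul, add_zero]
    exact hmin _
  have hcont : Continuous fun s : ℝ => p + s • V := by fun_prop
  have hev : ∀ᶠ s : ℝ in nhds 0, p + s • V ∈ S :=
    hcont.continuousAt.eventually_mem (hS.mem_nhds (by simpa using hp))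
  have hdχ : ∀ s : ℝ, p + s • V ∈ S →
      HasDerivAt (fun r : ℝ => χ (p + r • V)) (lineDeriv ℝ χ (p + s • V) V) s := by
    intro s hs
    rw [← deriv_along_line]
    refine DifferentiableAt.hasDerivAt (DifferentiableAt.comp (f := fun r : ℝ => p + r • V)
      (g := χ) s ?_ (by fun_prop))
    exact (hχ.differentiableOn two_ne_zero).differentiableAt (hS.mem_nhds hs)
  have hdf : ∀ s : ℝ, p + s • V ∈ S → HasDerivAt f (lineDeriv ℝ χ (p + s • V) V
      + κ * (Real.exp (l * lyapunov (x + s • v) z) * (l * (inner ℝ x v + s * ‖v‖ ^ 2)))) s :=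
    fun s hs => (hdχ s hs).add (hb s)
  have h0 : HasDerivAt f _ 0 := hdf 0 (by simpa using hp)
  constructor
  · have := hloc.hasDerivAt_eq_zero h0
    simp only [zero_smul, add_zero, zero_mul] at this
    linarith
  · have h2 := deriv_deriv_nonneg_of_isLocalMin hloc h0.continuousAt
    have hderiv : deriv f =ᶠ[nhds 0] fun s => lineDeriv ℝ χ (p + s • V) V
        + κ * (Real.exp (l * lyapunov (x + s • v) z) * (l * (inner ℝ x v + s * ‖v‖ ^ 2))) := by
      filter_upwards [hev] with s hs using (hdf s hs).deriv
    have hg : HasDerivAt (fun s : ℝ => lineDeriv ℝ χ (p + s • V) V)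
        (lineDeriv ℝ (fun q => lineDeriv ℝ χ q V) p V) 0 := by
      have hd : DifferentiableAt ℝ (fun q => lineDeriv ℝ χ q V) p :=
        ((contDiffOn_lineDeriv (k := 1) hS (by norm_num [one_add_one_eq_two]) hχ V).differentiableOn
          one_ne_zero).differentiableAt (hS.mem_nhds hp)
      exact hd.lineDifferentiableAt.hasLineDerivAt
    have hlin : HasDerivAt (fun s : ℝ => l * (inner ℝ x v + s * ‖v‖ ^ 2)) (l * (1 * ‖v‖ ^ 2)) 0 :=
      (((hasDerivAt_id (0 : ℝ)).mul_const _).const_add _).const_mul _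
    have hexp : HasDerivAt (fun s : ℝ => Real.exp (l * lyapunov (x + s • v) z)) _ 0 :=
      ((hasDerivAt_lyapunov_line x v z 0).const_mul l).exp
    have hsum := hg.add ((hexp.mul hlin).const_mul κ)
    rw [hderiv.deriv_eq] at h2
    replace h2 := h2.trans_eq hsum.deriv
    simp only [zero_smul, add_zero, zero_mul] at h2
    linarith

/-- `χ` plus a barrier with fast enough decay cannot have a minimum inside the slab. -/
theorem not_min_of_barrier (hχ : IsLinearSolution σ F G T χ) {K₁ K₂ : ℝ} (hK₂ : 0 ≤ K₂)
    (hσ : ∀ x i j, |σ x i j| ≤ K₁)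
    (hdrift : ∀ t ∈ Ioo 0 T, ∀ x z, inner ℝ x (G x z t) + z / √(1 + z ^ 2) * F x z t
      ≤ K₂ * (1 + ‖x‖ ^ 2 + |z|))
    {x : E n} {z t t₂ l₀ Λ κ : ℝ} (ht : t ∈ Ioo 0 T) (htt : t < t₂) (hκ : 0 < κ)
    (hl : 0 ≤ l₀ + Λ * (t₂ - t))
    (hΛ : (n * (n * K₁ ^ 2)) * ((l₀ + Λ * (t₂ - t)) + (l₀ + Λ * (t₂ - t)) ^ 2)
      + 4 * (l₀ + Λ * (t₂ - t)) * K₂ < Λ)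
    (hmin : ∀ y ζ, ∀ r ∈ Icc t t₂,
      χ (x, z, t) + κ * Real.exp ((l₀ + Λ * (t₂ - t)) * lyapunov x z)
        ≤ χ (y, ζ, r) + κ * Real.exp ((l₀ + Λ * (t₂ - r)) * lyapunov y ζ)) : False := by
  have hS : IsOpen (univ ×ˢ univ ×ˢ Ioo 0 T : Set (E n × ℝ × ℝ)) := isOpen_slab T
  have hp : (x, z, t) ∈ (univ ×ˢ univ ×ˢ Ioo 0 T : Set (E n × ℝ × ℝ)) :=
    ⟨mem_univ _, mem_univ _, ht⟩
  have hd : DifferentiableAt ℝ χ (x, z, t) :=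
    (hχ.contDiffOn.differentiableOn two_ne_zero).differentiableAt (hS.mem_nhds hp)
  have htmem : t ∈ Icc t t₂ := ⟨le_rfl, htt.le⟩
  have h1 := time_derivative_at_min htt hd (hmin x z)
  set l := l₀ + Λ * (t₂ - t)
  have h2 := z_derivative_at_min hd fun ζ => hmin x ζ t htmem
  have h3 := x_derivatives_at_min hS hχ.contDiffOn hp fun y => hmin y z t htmem
  set Y := κ * Real.exp (l * lyapunov x z)
  have hY : 0 < Y := by positivity
  have heq := hχ.equation t ht x z
  rw [h2, (h3 _).1] at heq
  -- Each of the `n` columns of `σ` has squared norm at most `n K₁²`, and Cauchy–Schwarz bounds `(x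
  -- · column)²`.
  have hsum : -(Y * (n * (n * K₁ ^ 2) * (l + l ^ 2 * ‖x‖ ^ 2))) ≤ ∑ k, lineDeriv ℝ
      (fun q => lineDeriv ℝ χ q (WithLp.toLp 2 ((σ x).col k), 0, 0)) (x, z, t)
        (WithLp.toLp 2 ((σ x).col k), 0, 0) := by
    calc -(Y * (n * (n * K₁ ^ 2) * (l + l ^ 2 * ‖x‖ ^ 2)))
        = ∑ _k : Fin n, -(Y * ((n * K₁ ^ 2) * (l + l ^ 2 * ‖x‖ ^ 2))) := by
          simp; ring
      _ ≤ _ := Finset.sum_le_sum fun k _ => ?_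
    refine le_trans ?_ (h3 _).2
    set w : E n := WithLp.toLp 2 ((σ x).col k)
    have hw : ‖w‖ ^ 2 ≤ n * K₁ ^ 2 := norm_sq_toLp_col_le (hσ x) k
    have hin : inner ℝ x w ^ 2 ≤ ‖x‖ ^ 2 * ‖w‖ ^ 2 := by
      rw [← mul_pow, ← sq_abs]
      exact pow_le_pow_left₀ (abs_nonneg _) (abs_real_inner_le_norm x w) 2
    refine neg_le_neg (mul_le_mul_of_nonneg_left ?_ hY.le)
    have hin' : inner ℝ x w ^ 2 ≤ ‖x‖ ^ 2 * (n * K₁ ^ 2) :=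
      hin.trans (mul_le_mul_of_nonneg_left hw (sq_nonneg _))
    have i1 := mul_le_mul_of_nonneg_left hw hl
    have i2 := mul_le_mul_of_nonneg_left hin' (sq_nonneg l)
    linarith
  have hdr := hdrift t ht x z
  have hV1 := one_le_lyapunov x z
  have hx := sq_norm_le_lyapunov x z
  have hz := abs_le_lyapunov x z
  set L := lyapunov x z
  -- The factor 4 collects `1 ≤ L`, `‖x‖² ≤ 2L` and `|z| ≤ L`.
  have hdr' : inner ℝ x (G x z t) + z / √(1 + z ^ 2) * F x z t ≤ K₂ * (4 * L) :=
    hdr.trans (mul_le_mul_of_nonneg_left (by linarith) hK₂)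
  have hB : (0 : ℝ) ≤ n * (n * K₁ ^ 2) := by positivity
  have j1 := mul_le_mul_of_nonneg_left hdr' (mul_nonneg hY.le hl)
  have j2 : n * (n * K₁ ^ 2) * (l + l ^ 2 * ‖x‖ ^ 2)
      ≤ n * (n * K₁ ^ 2) * (2 * (l + l ^ 2) * L) := by
    refine mul_le_mul_of_nonneg_left ?_ hB
    have := mul_le_mul_of_nonneg_left hx (sq_nonneg l)
    nlinarith
  have j3 := mul_le_mul_of_nonneg_left j2 hY.le
  -- The time derivative of `χ` is at least `YΛL`, while the equation bounds it by `YL` times the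
  -- left side of `hΛ`; the factor ½ of the second-order term cancels the 2 in `j2`.
  have j4 := mul_lt_mul_of_pos_left (mul_lt_mul_of_pos_right hΛ (zero_lt_one.trans_le hV1)) hY
  linarith

/-- Comparison with the barrier on a short time interval. -/
theorem barrier_nonneg (hχ : IsLinearSolution σ F G T χ) {K₁ K₂ C c : ℝ} (hK₂ : 0 ≤ K₂)
    (hσ : ∀ x i j, |σ x i j| ≤ K₁)
    (hdrift : ∀ t ∈ Ioo 0 T, ∀ x z, inner ℝ x (G x z t) + z / √(1 + z ^ 2) * F x z t
      ≤ K₂ * (1 + ‖x‖ ^ 2 + |z|))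
    (hc : 0 ≤ c)
    (hgrowth : ∀ t ∈ Icc 0 T, ∀ x z, -(C * Real.exp (c * lyapunov x z)) ≤ χ (x, z, t))
    {s t₂ Λ κ η : ℝ} (hs : 0 < s) (ht₂ : t₂ ≤ T) (hκ : 0 < κ) (hη : 0 ≤ η)
    (hstep : Λ * (t₂ - s) ≤ c + 1)
    (hΛ : (n * (n * K₁ ^ 2)) * (2 * (c + 1) + (2 * (c + 1)) ^ 2) + 4 * (2 * (c + 1)) * K₂ < Λ)
    (hend : ∀ x z, η ≤ χ (x, z, t₂) + κ * Real.exp ((c + 1) * lyapunov x z))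
    {t : ℝ} (ht : t ∈ Icc s t₂) (x : E n) (z : ℝ) :
    η ≤ χ (x, z, t) + κ * Real.exp ((c + 1 + Λ * (t₂ - t)) * lyapunov x z) := by
  have hΛ0 : 0 < Λ := lt_of_le_of_lt (by positivity) hΛ
  set w : E n × ℝ × ℝ → ℝ := fun p =>
    χ p + κ * Real.exp ((c + 1 + Λ * (t₂ - p.2.2)) * lyapunov p.1 p.2.1) with hw
  by_contra! hneg
  change w (x, z, t) < η at hneg
  -- Since `exp((c+1)L) ≥ L exp(cL)`, the barrier exceeds the growth bound by at least `η` as soon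
  -- as `κL ≥ C + η`.
  set R := (C + η) / κ
  -- outside the compact set `{V ≤ R}` the barrier dominates
  have hout : ∀ p : E n × ℝ × ℝ, p.2.2 ∈ Icc s t₂ → R < lyapunov p.1 p.2.1 → η ≤ w p := by
    rintro ⟨y, ζ, r⟩ hr hR
    simp only at hr hR
    have hg := hgrowth r ⟨hs.le.trans hr.1, hr.2.trans ht₂⟩ y ζ
    have hV1 := one_le_lyapunov y ζ
    simp only [hw]
    set L := lyapunov y ζ
    have hL0 : 0 ≤ L := by linarith
    have h1 : Real.exp (c * L) * L ≤ Real.exp ((c + 1 + Λ * (t₂ - r)) * L) := by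
      have hle : c * L + L ≤ (c + 1 + Λ * (t₂ - r)) * L := by
        have := mul_nonneg (mul_nonneg hΛ0.le (sub_nonneg.2 hr.2)) hL0
        linarith
      refine le_trans ?_ (Real.exp_le_exp.2 hle)
      rw [Real.exp_add]
      refine mul_le_mul_of_nonneg_left ?_ (Real.exp_pos _).le
      linarith [Real.add_one_le_exp L]
    have h2 : C + η ≤ κ * L := by
      have := (div_lt_iff₀ hκ).1 hR
      linarith
    have h3 : 1 ≤ Real.exp (c * L) := Real.one_le_exp (mul_nonneg hc hL0)
    have h4 := mul_le_mul_of_nonneg_left h1 hκ.le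
    have h5 := mul_le_mul_of_nonneg_left h2 (Real.exp_pos (c * L)).le
    have h6 := mul_le_mul_of_nonneg_left h3 hη
    linarith
  set Kc : Set (E n × ℝ × ℝ) := {p | lyapunov p.1 p.2.1 ≤ R ∧ p.2.2 ∈ Icc s t₂}
  have hin : ∀ p : E n × ℝ × ℝ, p.2.2 ∈ Icc s t₂ → w p < η → p ∈ Kc := fun p hp h =>
    ⟨not_lt.1 fun hR => (hout p hp hR).not_gt h, hp⟩
  have hwc : ContinuousOn w Kc := by
    refine ContinuousOn.add (hχ.continuousOn.mono ?_) (Continuous.continuousOn ?_)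
    · exact fun p hp => ⟨mem_univ _, mem_univ _, hs.le.trans hp.2.1, hp.2.2.trans ht₂⟩
    · have := continuous_lyapunov (n := n)
      fun_prop
  have hcomp : IsCompact Kc := isCompact_lyapunov_le R s t₂
  have hne : (x, z, t) ∈ Kc := hin _ ht hneg
  obtain ⟨⟨x₀, z₀, t₀⟩, hp₀, hmin⟩ :=
    hcomp.exists_isMinOn ⟨_, hne⟩ hwc
  have hlow : w (x₀, z₀, t₀) < η := (isMinOn_iff.1 hmin _ hne).trans_lt hneg
  have ht₀ : t₀ ∈ Icc s t₂ := hp₀.2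
  -- The end time is excluded by `hend`; with `s > 0` this puts the minimum inside the open slab,
  -- where the equation holds.
  have hlt : t₀ < t₂ := by
    refine lt_of_le_of_ne ht₀.2 ?_
    rintro rfl
    have := hend x₀ z₀
    simp only [hw, sub_self, mul_zero, add_zero] at hlow
    linarith
  have hb0 : 0 ≤ Λ * (t₂ - t₀) := mul_nonneg hΛ0.le (sub_nonneg.2 hlt.le)
  have hb1 : Λ * (t₂ - t₀) ≤ c + 1 :=
    (mul_le_mul_of_nonneg_left (by linarith [ht₀.1]) hΛ0.le).trans hstep
  refine not_min_of_barrier hχ hK₂ hσ hdrift (x := x₀) (z := z₀) (t := t₀) (t₂ := t₂)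
    (l₀ := c + 1) (Λ := Λ) ⟨hs.trans_le ht₀.1, hlt.trans_le ht₂⟩ hlt hκ (by positivity) ?_ ?_
  · refine lt_of_le_of_lt ?_ hΛ
    have hl : c + 1 + Λ * (t₂ - t₀) ≤ 2 * (c + 1) := by linarith
    gcongr
  · intro y ζ r hr
    have hr' : (y, ζ, r).2.2 ∈ Icc s t₂ := ⟨ht₀.1.trans hr.1, hr.2⟩
    -- A minimum over the compact set is global: wherever `w < η` the point lies in that set, and
    -- elsewhere `w` is at least `η`, which exceeds the minimum.
    change w (x₀, z₀, t₀) ≤ w (y, ζ, r)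
    rcases lt_or_ge (w (y, ζ, r)) η with h | h
    · exact isMinOn_iff.1 hmin _ (hin _ hr' h)
    · exact hlow.le.trans h

/-- Positivity propagates backwards over a time interval of controlled length. -/
theorem pos_of_pos_at_end (hχ : IsLinearSolution σ F G T χ) {K₁ K₂ C c : ℝ} (hK₂ : 0 ≤ K₂)
    (hσ : ∀ x i j, |σ x i j| ≤ K₁)
    (hdrift : ∀ t ∈ Ioo 0 T, ∀ x z, inner ℝ x (G x z t) + z / √(1 + z ^ 2) * F x z t
      ≤ K₂ * (1 + ‖x‖ ^ 2 + |z|))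
    (hc : 0 ≤ c)
    (hgrowth : ∀ t ∈ Icc 0 T, ∀ x z, -(C * Real.exp (c * lyapunov x z)) ≤ χ (x, z, t))
    {t₁ t₂ Λ : ℝ} (ht₁ : 0 ≤ t₁) (ht₁₂ : t₁ < t₂) (ht₂ : t₂ ≤ T)
    (hstep : Λ * (t₂ - t₁) ≤ c + 1)
    (hΛ : (n * (n * K₁ ^ 2)) * (2 * (c + 1) + (2 * (c + 1)) ^ 2) + 4 * (2 * (c + 1)) * K₂ < Λ)
    (hend : ∀ x z, 0 < χ (x, z, t₂)) (x : E n) (z : ℝ) : 0 < χ (x, z, t₁) := by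
  have hΛ0 : 0 < Λ := lt_of_le_of_lt (by positivity) hΛ
  have hV1 := one_le_lyapunov x z
  set L := lyapunov x z
  -- The exponent at `(x, z)` can double to `2(c+1)L` during the step; the extra 1 keeps it strictly
  -- below `(c+1)R`.
  set R := 2 * L + 1
  set M := Real.exp ((c + 1) * R)
  have hM : 0 < M := Real.exp_pos _
  have hcont : ContinuousOn χ {p : E n × ℝ × ℝ | lyapunov p.1 p.2.1 ≤ R ∧ p.2.2 ∈ Icc t₂ t₂} :=
    hχ.continuousOn.mono fun p hp => ⟨mem_univ _, mem_univ _,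
      (ht₁.trans ht₁₂.le).trans hp.2.1, hp.2.2.trans ht₂⟩
  obtain ⟨⟨x₀, z₀, t₀⟩, hp₀, hmin⟩ := (isCompact_lyapunov_le (n := n) R t₂ t₂).exists_isMinOn
    ⟨(x, z, t₂), by simp only [R]; linarith, le_rfl, le_rfl⟩ hcont
  obtain rfl : t₀ = t₂ := le_antisymm hp₀.2.2 hp₀.2.1
  set η := χ (x₀, z₀, t₀)
  have hη : 0 < η := hend x₀ z₀
  -- With `κ = η/M` the barrier at the end time already exceeds `η` where `V > R`; where `V ≤ R`,
  -- the minimality of `η` suffices.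
  have hκ : 0 < η / M := div_pos hη hM
  have hbar : ∀ s ∈ Ioc t₁ t₀, η ≤ χ (x, z, s)
      + η / M * Real.exp ((c + 1 + Λ * (t₀ - s)) * L) := by
    intro s hs
    refine barrier_nonneg hχ hK₂ hσ hdrift hc hgrowth (ht₁.trans_lt hs.1) ht₂ hκ hη.le ?_ hΛ ?_
      (left_mem_Icc.2 hs.2) x z
    · exact (mul_le_mul_of_nonneg_left (by linarith [hs.1]) hΛ0.le).trans hstep
    · intro y ζ
      rcases le_or_gt (lyapunov y ζ) R with h | h
      · have h1 : η ≤ χ (y, ζ, t₀) := hmin (show (y, ζ, t₀) ∈ _ from ⟨h, le_rfl, le_rfl⟩)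
        have := mul_pos hκ (Real.exp_pos ((c + 1) * lyapunov y ζ))
        linarith
      · have h1 : M ≤ Real.exp ((c + 1) * lyapunov y ζ) :=
          Real.exp_le_exp.2 (mul_le_mul_of_nonneg_left h.le (by linarith))
        have h2 := mul_le_mul_of_nonneg_left h1 hκ.le
        rw [div_mul_cancel₀ _ hM.ne'] at h2
        linarith [hend y ζ]
  have hlow : ∀ s ∈ Ioc t₁ t₀, η - η / M * Real.exp (2 * (c + 1) * L) ≤ χ (x, z, s) := by
    intro s hs
    have h1 : Real.exp ((c + 1 + Λ * (t₀ - s)) * L) ≤ Real.exp (2 * (c + 1) * L) := by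
      refine Real.exp_le_exp.2 (mul_le_mul_of_nonneg_right ?_ (by linarith))
      have := (mul_le_mul_of_nonneg_left (by linarith [hs.1] : t₀ - s ≤ t₀ - t₁) hΛ0.le).trans hstep
      linarith
    have h2 := mul_le_mul_of_nonneg_left h1 hκ.le
    linarith [hbar s hs]
  have hpos : 0 < η - η / M * Real.exp (2 * (c + 1) * L) := by
    have h1 : Real.exp (2 * (c + 1) * L) < M := Real.exp_lt_exp.2 (by simp only [R]; linarith)
    have h2 := mul_lt_mul_of_pos_left h1 hκ
    rw [div_mul_cancel₀ _ hM.ne'] at h2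
    linarith
  -- The lower bound is uniform in `s > t₁`, so it passes to `t₁` by continuity; this covers `t₁ =
  -- 0`, where no equation is available.
  refine hpos.trans_le ?_
  have hc1 : ContinuousWithinAt (fun s => χ (x, z, s)) (Icc 0 T) t₁ :=
    ContinuousWithinAt.comp (f := fun s : ℝ => (x, z, s)) (g := χ)
      (hχ.continuousOn (x, z, t₁) ⟨mem_univ _, mem_univ _, ht₁, ht₁₂.le.trans ht₂⟩)
      (by fun_prop) fun s hs => ⟨mem_univ _, mem_univ _, hs⟩
  have hc2 : Filter.Tendsto (fun s => χ (x, z, s)) (nhdsWithin t₁ (Ioc t₁ t₀))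
      (nhds (χ (x, z, t₁))) :=
    hc1.mono fun s hs => ⟨ht₁.trans hs.1.le, hs.2.trans ht₂⟩
  have : (nhdsWithin t₁ (Ioc t₁ t₀)).NeBot := by
    rw [nhdsWithin_Ioc_eq_nhdsGT ht₁₂]
    infer_instance
  exact ge_of_tendsto hc2 (Filter.eventually_of_mem self_mem_nhdsWithin hlow)

/-- Strict positivity of solutions with positive terminal value, under the growth conditions. -/
theorem IsLinearSolution.pos (hχ : IsLinearSolution σ F G T χ) {K₁ K₂ C c : ℝ} (hK₂ : 0 ≤ K₂)
    (hσ : ∀ x i j, |σ x i j| ≤ K₁)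
    (hdrift : ∀ t ∈ Ioo 0 T, ∀ x z, inner ℝ x (G x z t) + z / √(1 + z ^ 2) * F x z t
      ≤ K₂ * (1 + ‖x‖ ^ 2 + |z|))
    (hc : 0 ≤ c)
    (hgrowth : ∀ t ∈ Icc 0 T, ∀ x z, -(C * Real.exp (c * lyapunov x z)) ≤ χ (x, z, t))
    (hend : ∀ x z, 0 < χ (x, z, T)) {t : ℝ} (ht : t ∈ Icc 0 T) (x : E n) (z : ℝ) :
    0 < χ (x, z, t) := by
  obtain ⟨Λ, hΛ⟩ := exists_gt
    ((n * (n * K₁ ^ 2)) * (2 * (c + 1) + (2 * (c + 1)) ^ 2) + 4 * (2 * (c + 1)) * K₂)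
  have hΛ0 : 0 < Λ := lt_of_le_of_lt (by positivity) hΛ
  -- The longest step allowed by `hstep`; it is independent of the starting time, so finitely many
  -- steps reach any `t`.
  set δ := (c + 1) / Λ
  have hδ : 0 < δ := by positivity
  have key : ∀ N : ℕ, ∀ t ∈ Icc 0 T, T - t ≤ N * δ → ∀ x z, 0 < χ (x, z, t) := by
    intro N
    induction N with
    | zero =>
      intro t ht hN
      obtain rfl : t = T := le_antisymm ht.2 (by simpa using hN)
      exact hend
    | succ N ih =>
      intro t ht hN
      rcases ht.2.eq_or_lt with rfl | hlt
      · exact hend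
      have hmem : min T (t + δ) ∈ Icc 0 T :=
        ⟨le_min (ht.1.trans ht.2) (by linarith [ht.1]), min_le_left _ _⟩
      refine pos_of_pos_at_end hχ hK₂ hσ hdrift hc hgrowth ht.1 (t₂ := min T (t + δ))
        (lt_min hlt (by linarith)) hmem.2 ?_ hΛ (ih _ hmem ?_)
      · have : min T (t + δ) - t ≤ δ := by linarith [min_le_right T (t + δ)]
        refine (mul_le_mul_of_nonneg_left this hΛ0.le).trans_eq ?_
        exact mul_div_cancel₀ _ hΛ0.ne'
      · push_cast at hN
        rcases min_choice T (t + δ) with h | h <;> rw [h]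
        · rw [sub_self]; positivity
        · linarith
  obtain ⟨N, hN⟩ := exists_nat_ge ((T - t) / δ)
  exact key N t ht ((div_le_iff₀ hδ).1 hN) x z

end MaximumPrinciple

/-! ### Applying the maximum principle to `∂u/∂z`. -/

section Positivity

variable {n d : ℕ} {P : Model n d} {vstar : E n → L2 n → E n → ℝ → E d}
    {dh : E n → L2 n → E n → ℝ} {dH : E n → L2 n → E n → ℝ → E n → ℝ}
    {u : E n → ℝ → ℝ → ℝ} {μ : ℝ → Measure (E n × ℝ)} {m : ℝ → L2 n}

theorem sum_smul_single_eq (σ : Matrix (Fin n) (Fin n) ℝ) (k : Fin n) :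
    ∑ i, σ i k • ((EuclideanSpace.single i 1, 0, 0) : E n × ℝ × ℝ)
      = (WithLp.toLp 2 (σ.col k), 0, 0) := by
  ext i
  · simp [Prod.fst_sum, Finset.sum_apply, Pi.single_apply]
  · simp [Prod.snd_sum]
  · simp [Prod.snd_sum]

theorem isLinearSolution_Dz (hu : IsAdjointSolution P vstar dh dH u μ m) :
    IsLinearSolution P.σ (P.loopF vstar u m) (P.loopG vstar u m) P.T
      (fun q => Dz u q.1 q.2.1 q.2.2) where
  contDiffOn := contDiffOn_Dz hu
  continuousOn := hu.Dz_continuousOn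
  equation t ht x z := by
    have hp : (x, z, t) ∈ (univ ×ˢ univ ×ˢ Ioo 0 P.T : Set (E n × ℝ × ℝ)) :=
      ⟨mem_univ _, mem_univ _, ht⟩
    have hd := ((contDiffOn_Dz hu).differentiableOn two_ne_zero).differentiableAt
      ((isOpen_slab P.T).mem_nhds hp)
    have h := Dz_equation hu ht x z
    have e1 := Dt_eq_lineDeriv (Dz u) (x, z, t)
    have e2 := Dz_eq_lineDeriv (Dz u) (x, z, t)
    have e3 := A_eq_lineDeriv P (Dz u) (x, z, t)
    have e4 := inner_Dx_eq_lineDeriv (u := Dz u) (p := (x, z, t)) hd (P.loopG vstar u m x z t)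
    have e5 := sum_mul_transpose_lineDeriv (isOpen_slab P.T) (contDiffOn_Dz hu) hp (P.σ x)
      (fun i => ((EuclideanSpace.single i 1, 0, 0) : E n × ℝ × ℝ))
    simp only [sum_smul_single_eq] at e5
    simp only [Model.a] at e1 e2 e3 e4
    rw [e1, e2, e3, e4, e5] at h
    exact h

end Positivity

end RiskSensitive

theorem lemma1 {n d : ℕ} (P : RiskSensitive.Model n d)
    (hα : 0 < P.α) (hT : 0 < P.T) (hm₀ : RiskSensitive.IsProbDensity P.m₀)
    (vstar : RiskSensitive.E n → RiskSensitive.L2 n → RiskSensitive.E n → ℝ → RiskSensitive.E d)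
    (dh : RiskSensitive.E n → RiskSensitive.L2 n → RiskSensitive.E n → ℝ)
    (dH : RiskSensitive.E n → RiskSensitive.L2 n → RiskSensitive.E n → ℝ →
      RiskSensitive.E n → ℝ)
    (u : RiskSensitive.E n → ℝ → ℝ → ℝ)
    (μ : ℝ → MeasureTheory.Measure (RiskSensitive.E n × ℝ))
    (m : ℝ → RiskSensitive.L2 n)
    (hu : RiskSensitive.IsAdjointSolution P vstar dh dH u μ m)
    (χ : RiskSensitive.E n → ℝ → ℝ → ℝ) (hχ : χ = RiskSensitive.Dz u)
    -- growth hypotheses: bounded diffusion coefficient, one-sided growth of the closed-loop drift,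
    -- and at most Gaussian (in `x`) and exponential (in `z`) growth of the negative part of `χ`
    (hσ : ∃ K : ℝ, ∀ x i j, |P.σ x i j| ≤ K)
    (hdrift : ∃ K : ℝ, ∀ t ∈ Set.Ioo 0 P.T, ∀ x z,
      inner ℝ x (P.loopG vstar u m x z t) + z / √(1 + z ^ 2) * P.loopF vstar u m x z t
        ≤ K * (1 + ‖x‖ ^ 2 + |z|))
    (hgrowth : ∃ C c : ℝ, ∀ t ∈ Set.Icc 0 P.T, ∀ x z,
      -(C * Real.exp (c * (‖x‖ ^ 2 + |z|))) ≤ χ x z t) :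
    (∀ x z, χ x z P.T = P.α * Real.exp (P.α * (z + P.h x (m P.T)))) ∧
    (∀ t ∈ Set.Ioo 0 P.T, ∀ x z,
      -RiskSensitive.Dt χ x z t + P.A (fun y => χ y z t) x
        = RiskSensitive.Dz χ x z t * P.loopF vstar u m x z t
          + inner ℝ (RiskSensitive.Dx χ x z t) (P.loopG vstar u m x z t)) ∧
    (∀ t ∈ Set.Icc 0 P.T, ∀ x z, 0 < χ x z t) := by
  subst hχ
  refine ⟨RiskSensitive.Dz_terminal hu, fun t ht x z => RiskSensitive.Dz_equation hu ht x z, ?_⟩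
  obtain ⟨K₁, hK₁⟩ := hσ
  obtain ⟨K₂, hK₂⟩ := hdrift
  obtain ⟨C, c, hCc⟩ := hgrowth
  intro t ht x z
  -- Absolute values supply the sign conditions, and `2|c|` comes from `‖x‖² + |z| ≤ 2V`.
  refine (RiskSensitive.isLinearSolution_Dz hu).pos (K₂ := |K₂|) (C := |C|) (c := 2 * |c|)
    (abs_nonneg _) hK₁ ?_ (by positivity) ?_ ?_ ht x z
  · exact fun t ht x z => (hK₂ t ht x z).trans
      (mul_le_mul_of_nonneg_right (le_abs_self _) (by positivity))
  · intro t ht x z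
    refine le_trans (neg_le_neg ?_) (hCc t ht x z)
    refine mul_le_mul (le_abs_self C) (Real.exp_le_exp.2 ?_) (Real.exp_pos _).le (abs_nonneg _)
    calc c * (‖x‖ ^ 2 + |z|) ≤ |c| * (‖x‖ ^ 2 + |z|) :=
          mul_le_mul_of_nonneg_right (le_abs_self c) (by positivity)
      _ ≤ |c| * (2 * RiskSensitive.lyapunov x z) :=
          mul_le_mul_of_nonneg_left (RiskSensitive.sq_norm_add_abs_le_lyapunov x z) (abs_nonneg _)
      _ = 2 * |c| * RiskSensitive.lyapunov x z := by ring
  · intro x z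
    simp only [RiskSensitive.Dz_terminal hu]
    positivity
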